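/- Let $\mathcal F_{op}$ be the set of functions $f\colon(0,\infty)\to(0,\infty)$ that are operator monotone (that is, $0<X\le Y$ implies $f(X)\le f(Y)$ for matrices $X,Y$ of every order) and satisfy $f(t)=t f(t^{-1})$ for all $t>0$ and $f(1)=1$. Put $f(0)=\lim_{t\to0^+}f(t)$ and call $f$ regular if $f(0)>0$. The associated Morozova–Chentsov function is $c(x,y)=\dfrac{1}{y f(xy^{-1})}$ for $x,y>0$. For a positive definite density matrix $\rho$ let $L_\rho X=\rho X$, $R_\rho X=X\rho$, let $K^c_\rho(X,Y)=\operatorname{Tr}X^*c(L_\rho,R_\rho)Y$, and, for $f$ regular, define the metric adjusted skew information $$I^c_\rho(A)=\frac{f(0)}{2}K^c_\rho\big(i[\rho,A],i[\rho,A]\big),$$ extended by continuity in $\rho$ to all (positive semidefinite, trace one) density matrices. **Proposition.** Let $f\in\mathcal F_{op}$ be regular with associated Morozova–Chentsov function $c$, let $H_1,H_2$ be finite-dimensional complex Hilbert spaces, and let $\rho$ be a density operator on $H_1\otimes H_2$ with partial traces $\rho_1=\operatorname{Tr}_2\rho$ on $H_1$ and $\rho_2=\operatorname{Tr}_1\rho$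 on $H_2$. Then for all self-adjoint operators $A$ on $H_1$ and $B$ on $H_2$, $$I^c_\rho(A\otimes \mathbf 1_2+\mathbf 1_1\otimes B)\ \ge\ \tfrac12\big(I^c_{\rho_1}(A)+I^c_{\rho_2}(B)\big)$$ and $$I^c_\rho(A\otimes \mathbf 1_2+\mathbf 1_1\otimes B)+I^c_\rho(A\otimes \mathbf 1_2-\mathbf 1_1\otimes B)\ \ge\ 2\big(I^c_{\rho_1}(A)+I^c_{\rho_2}(B)\big).$$ -/

import Mathlib

open Matrix Topology Filter
open scoped Kronecker ComplexOrder

noncomputable section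

namespace SkewInfo

/-! ### Operator monotone functions and the class `F_op` -/

/-- A function on the positive half-line is operator monotone if `A ≤ B` implies `f(A) ≤ f(B)` for
positive definite matrices of every order; `f(A)` is the functional calculus. Only the values of
`f` on `(0, ∞)` matter. -/
def OperatorMonotone (f : ℝ → ℝ) : Prop :=
  ∀ (k : ℕ) (A B : Matrix (Fin k) (Fin k) ℂ), A.PosDef → B.PosDef →
    (B - A).PosSemidef → (cfc f B - cfc f A).PosSemidef

/-- The class `F_op` of functions `f : (0, ∞) → (0, ∞)`. -/
structure IsFop (f : ℝ → ℝ) : Prop where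
  pos : ∀ t, 0 < t → 0 < f t
  operatorMonotone : OperatorMonotone f
  symm : ∀ t, 0 < t → f t = t * f t⁻¹
  one : f 1 = 1

/-- The value `f(0)` of the continuous extension of `f` from `(0, ∞)` to `[0, ∞)`. This is also the
metric constant `m(c)`. -/
def valueAtZero (f : ℝ → ℝ) : ℝ := limUnder (𝓝[>] (0 : ℝ)) f

/-- `f` is regular if `f(0) > 0`. -/
def IsRegular (f : ℝ → ℝ) : Prop := 0 < valueAtZero f

/-- The Morozova-Chentsov function `c(x, y) = 1 / (y f(x / y))`, for `x, y > 0`. -/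
def morozovaChentsov (f : ℝ → ℝ) (x y : ℝ) : ℝ := 1 / (y * f (x / y))

/-! ### Density operators and partial traces -/

/-- Density matrices: positive semidefinite with trace one. -/
@[ext]
structure DensityMatrix (n : Type*) [Fintype n] where
  toMatrix : Matrix n n ℂ
  posSemidef : toMatrix.PosSemidef
  trace_eq_one : toMatrix.trace = 1

namespace DensityMatrix

variable {m n : Type*} [Fintype m] [Fintype n]

/-- The topology of the state space, as a subspace of the space of matrices. -/
instance : TopologicalSpace (DensityMatrix n) := TopologicalSpace.induced toMatrix inferInstance

theorem isHermitian (ρ : DensityMatrix n) : ρ.toMatrix.IsHermitian := ρ.posSemidef.isHermitian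

/-- The partial trace over the second factor, the state of the first party. -/
def partialTrace₂ (ρ : DensityMatrix (m × n)) : DensityMatrix m where
  toMatrix := Matrix.of fun i j => ∑ k, ρ.toMatrix (i, k) (j, k)
  posSemidef := by
    have h : (Matrix.of fun i j => ∑ k, ρ.toMatrix (i, k) (j, k)) =
        ∑ k, ρ.toMatrix.submatrix (fun i : m => (i, k)) (fun i : m => (i, k)) := by
      ext i j
      simp [Matrix.sum_apply]
    rw [h]
    exact Matrix.posSemidef_sum _ fun k _ => ρ.posSemidef.submatrix _
  trace_eq_one := by
    rw [← ρ.trace_eq_one]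
    simp [Matrix.trace, Fintype.sum_prod_type]

/-- The partial trace over the first factor, the state of the second party. -/
def partialTrace₁ (ρ : DensityMatrix (m × n)) : DensityMatrix n where
  toMatrix := Matrix.of fun i j => ∑ k, ρ.toMatrix (k, i) (k, j)
  posSemidef := by
    have h : (Matrix.of fun i j => ∑ k, ρ.toMatrix (k, i) (k, j)) =
        ∑ k, ρ.toMatrix.submatrix (fun i : n => (k, i)) (fun i : n => (k, i)) := by
      ext i j
      simp [Matrix.sum_apply]
    rw [h]
    exact Matrix.posSemidef_sum _ fun k _ => ρ.posSemidef.submatrix _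
  trace_eq_one := by
    rw [← ρ.trace_eq_one]
    simp [Matrix.trace, Fintype.sum_prod_type_right]

/-- The state manifold: the positive definite density matrices. -/
def stateManifold (n : Type*) [Fintype n] : Set (DensityMatrix n) :=
  {ρ | ρ.toMatrix.PosDef}

end DensityMatrix

/-! ### Functions of left and right multiplication -/

section Calculus

variable {n : Type*} [Fintype n] [DecidableEq n]

/-- `X ↦ U (g(lam i, lam j) (Uᴴ X U) i j)_{i j} Uᴴ`. -/
def spectralForm (g : ℝ → ℝ → ℝ) (U : Matrix n n ℂ) (lam : n → ℝ) (X : Matrix n n ℂ) :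
    Matrix n n ℂ :=
  U * (Matrix.of fun i j => (g (lam i) (lam j) : ℂ) * (Uᴴ * X * U) i j) * Uᴴ

/-- `g(L_ρ, R_ρ) X` for the commuting operators `L_ρ X = ρ X` and `R_ρ X = X ρ`: if
`(u i)` is an orthonormal eigenbasis of `ρ` with eigenvalues `lam i`, the rank one operators
`|u i⟩⟨u j|` are joint eigenvectors of `L_ρ, R_ρ` with eigenvalues `(lam i, lam j)`. -/
def leftRight (g : ℝ → ℝ → ℝ) {ρ : Matrix n n ℂ} (hρ : ρ.IsHermitian) (X : Matrix n n ℂ) :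
    Matrix n n ℂ :=
  spectralForm g (hρ.eigenvectorUnitary : Matrix n n ℂ) hρ.eigenvalues X

/-- The monotone metric `K_ρ(A, B) = Tr A* c(L_ρ, R_ρ) B`. -/
def monotoneMetric (f : ℝ → ℝ) (ρ : DensityMatrix n) (A B : Matrix n n ℂ) : ℂ :=
  (Aᴴ * leftRight (morozovaChentsov f) ρ.isHermitian B).trace

/-- `f(0)/2 K_ρ(i[ρ, A], i[ρ, A])`, for `ρ` in the state manifold. -/
def skewInformationOnManifold (f : ℝ → ℝ) (ρ : DensityMatrix n) (A : Matrix n n ℂ) : ℝ :=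
  valueAtZero f / 2 *
    (monotoneMetric f ρ (Complex.I • (ρ.toMatrix * A - A * ρ.toMatrix))
      (Complex.I • (ρ.toMatrix * A - A * ρ.toMatrix))).re

/-- The metric adjusted skew information: the extension by continuity of
`skewInformationOnManifold` from the state manifold to all density matrices. That the extension
exists and is continuous, and agrees with `skewInformationOnManifold` on the state manifold, is
proved below. -/
def skewInformation (f : ℝ → ℝ) (ρ : DensityMatrix n) (A : Matrix n n ℂ) : ℝ :=
  extendFrom (DensityMatrix.stateManifold n) (fun σ => skewInformationOnManifold f σ A) ρ

end Calculus

/-! ### The definitions are well behaved -/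

theorem IsFop.monotone {f : ℝ → ℝ} (hf : IsFop f) {s t : ℝ} (hs : 0 < s) (hst : s ≤ t) :
    f s ≤ f t := by
  have key : ∀ r : ℝ, 0 < r → (algebraMap ℝ (Matrix (Fin 1) (Fin 1) ℂ) r).PosDef := by
    intro r hr
    rw [show algebraMap ℝ (Matrix (Fin 1) (Fin 1) ℂ) r = Matrix.diagonal fun _ => (r : ℂ) by
      ext i j; simp [Matrix.algebraMap_matrix_apply, Matrix.diagonal_apply]]
    exact Matrix.PosDef.diagonal fun _ => by exact_mod_cast hr
  have h := hf.operatorMonotone 1 (algebraMap ℝ _ s) (algebraMap ℝ _ t) (key s hs)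
    (key t (hs.trans_le hst)) (by
      rw [← map_sub, show algebraMap ℝ (Matrix (Fin 1) (Fin 1) ℂ) (t - s) =
        Matrix.diagonal fun _ => ((t - s : ℝ) : ℂ) by
          ext i j; simp [Matrix.algebraMap_matrix_apply, Matrix.diagonal_apply]]
      exact Matrix.PosSemidef.diagonal fun _ => by
        simp only [Pi.zero_apply]; exact_mod_cast sub_nonneg.2 hst)
  rw [cfc_algebraMap, cfc_algebraMap, ← map_sub] at h
  have h0 := h.diag_nonneg (i := 0)
  rw [Matrix.algebraMap_matrix_apply] at h0
  simp only [if_true, Complex.coe_algebraMap] at h0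
  exact sub_nonneg.1 (by exact_mod_cast h0)

theorem IsFop.div_antitone {f : ℝ → ℝ} (hf : IsFop f) {s t : ℝ} (hs : 0 < s) (hst : s ≤ t) :
    f t ≤ t / s * f s := by
  have ht := hs.trans_le hst
  rw [hf.symm t ht, hf.symm s hs]
  have := hf.monotone (inv_pos.2 ht) (inv_anti₀ hs hst)
  rw [show t / s * (s * f s⁻¹) = t * f s⁻¹ by field_simp]
  exact mul_le_mul_of_nonneg_left this ht.le

theorem IsFop.continuousAt {f : ℝ → ℝ} (hf : IsFop f) {t : ℝ} (ht : 0 < t) :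
    ContinuousAt f t := by
  have h1 : Tendsto (fun u => min 1 (u / t) * f t) (𝓝 t) (𝓝 (f t)) := by
    have : ContinuousAt (fun u => min 1 (u / t) * f t) t := by fun_prop
    simpa [ContinuousAt, ht.ne'] using this
  have h2 : Tendsto (fun u => max 1 (u / t) * f t) (𝓝 t) (𝓝 (f t)) := by
    have : ContinuousAt (fun u => max 1 (u / t) * f t) t := by fun_prop
    simpa [ContinuousAt, ht.ne'] using this
  refine tendsto_of_tendsto_of_tendsto_of_le_of_le' h1 h2 ?_ ?_ <;>
    filter_upwards [lt_mem_nhds ht] with u hu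
  · rcases le_total u t with h | h
    · rw [min_eq_right ((div_le_one ht).2 h)]
      have := mul_le_mul_of_nonneg_left (hf.div_antitone hu h) (div_pos hu ht).le
      rwa [show u / t * (t / u * f u) = f u by field_simp] at this
    · rw [min_eq_left ((one_le_div ht).2 h), one_mul]
      exact hf.monotone ht h
  · rcases le_total u t with h | h
    · rw [max_eq_left ((div_le_one ht).2 h), one_mul]
      exact hf.monotone hu h
    · rw [max_eq_right ((one_le_div ht).2 h)]
      exact hf.div_antitone ht h

theorem IsFop.tendsto_zero {f : ℝ → ℝ} (hf : IsFop f) :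
    Tendsto f (𝓝[>] 0) (𝓝 (valueAtZero f)) := by
  have hm : MonotoneOn f (Set.Ioi 0) := fun s hs t _ hst => hf.monotone hs hst
  have hb : BddBelow (f '' Set.Ioi 0) :=
    ⟨0, by rintro _ ⟨t, ht, rfl⟩; exact (hf.pos t ht).le⟩
  exact tendsto_nhds_limUnder ⟨_, hm.tendsto_nhdsGT hb⟩

/-- `f` extended to the closed half-line. -/
def extended (f : ℝ → ℝ) (t : ℝ) : ℝ := if t ≤ 0 then valueAtZero f else f t

theorem IsFop.continuous_extended {f : ℝ → ℝ} (hf : IsFop f) : Continuous (extended f) := by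
  rw [continuous_iff_continuousAt]
  intro t
  rcases lt_trichotomy t 0 with ht | rfl | ht
  · refine continuousAt_const.congr (f := fun _ => valueAtZero f) ?_
    filter_upwards [gt_mem_nhds ht] with u hu
    simp [extended, le_of_lt hu]
  · rw [continuousAt_iff_continuous_left'_right']
    constructor
    · refine continuousWithinAt_const.congr (f := fun _ => valueAtZero f) ?_ ?_
      · intro u hu
        simp [extended, le_of_lt (Set.mem_Iio.1 hu)]
      · simp [extended]
    · have : Tendsto (extended f) (𝓝[>] 0) (𝓝 (valueAtZero f)) := by
        refine hf.tendsto_zero.congr' ?_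
        filter_upwards [self_mem_nhdsWithin] with u hu
        simp [extended, not_le.2 (Set.mem_Ioi.1 hu)]
      simpa [ContinuousWithinAt, extended] using this
  · refine (hf.continuousAt ht).congr ?_
    filter_upwards [lt_mem_nhds ht] with u hu
    simp [extended, not_le.2 hu]

theorem IsFop.valueAtZero_le_extended {f : ℝ → ℝ} (hf : IsFop f) (t : ℝ) :
    valueAtZero f ≤ extended f t := by
  unfold extended
  split_ifs with h
  · exact le_rfl
  · push Not at h
    refine le_of_tendsto hf.tendsto_zero ?_
    filter_upwards [Ioo_mem_nhdsGT h] with u hu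
    exact hf.monotone hu.1 hu.2.le

/-- The function `(x - y)² c(x, y)`, extended by continuity to the closed quadrant. -/
def cHat (f : ℝ → ℝ) (x y : ℝ) : ℝ :=
  (x - y) ^ 2 / (max x y * extended f (min x y / max x y))

theorem IsFop.cHat_eq {f : ℝ → ℝ} (hf : IsFop f) {x y : ℝ} (hx : 0 < x) (hy : 0 < y) :
    cHat f x y = (x - y) ^ 2 * morozovaChentsov f x y := by
  have e : max x y * extended f (min x y / max x y) = y * f (x / y) := by
    rcases le_total x y with h | h
    · rw [max_eq_right h, min_eq_left h, extended, if_neg (not_le.2 (div_pos hx hy))]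
    · rw [max_eq_left h, min_eq_right h, extended, if_neg (not_le.2 (div_pos hy hx)),
        hf.symm (x / y) (div_pos hx hy), inv_div]
      field_simp
  rw [cHat, e, morozovaChentsov]
  ring

theorem IsFop.continuousOn_cHat {f : ℝ → ℝ} (hf : IsFop f) (hreg : IsRegular f) :
    ContinuousOn (fun p : ℝ × ℝ => cHat f p.1 p.2) (Set.Ici 0 ×ˢ Set.Ici 0) := by
  have hc := hf.continuous_extended
  have hpos : ∀ t, 0 < extended f t := fun t =>
    lt_of_lt_of_le hreg (hf.valueAtZero_le_extended t)
  rintro ⟨x, y⟩ ⟨hx, hy⟩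
  simp only [Set.mem_Ici] at hx hy
  by_cases h0 : max x y = 0
  · have hx0 : x = 0 := le_antisymm (h0 ▸ le_max_left x y) hx
    have hy0 : y = 0 := le_antisymm (h0 ▸ le_max_right x y) hy
    subst hx0 hy0
    have hz : cHat f 0 0 = 0 := by simp [cHat]
    have hlim : Tendsto (fun p : ℝ × ℝ => max p.1 p.2 / valueAtZero f)
        (𝓝[Set.Ici 0 ×ˢ Set.Ici 0] (0, 0)) (𝓝 0) := by
      have : Continuous (fun p : ℝ × ℝ => max p.1 p.2 / valueAtZero f) := by fun_prop
      have h := (this.tendsto (0, 0)).mono_left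
        (nhdsWithin_le_nhds (s := Set.Ici (0 : ℝ) ×ˢ Set.Ici (0 : ℝ)))
      simpa using h
    change Tendsto _ _ (𝓝 (cHat f 0 0))
    rw [hz]
    refine tendsto_of_tendsto_of_tendsto_of_le_of_le' tendsto_const_nhds hlim ?_ ?_ <;>
      filter_upwards [self_mem_nhdsWithin] with p hp <;>
      obtain ⟨h1, h2⟩ := hp <;> simp only [Set.mem_Ici] at h1 h2 <;>
      have hM : 0 ≤ max p.1 p.2 := le_max_of_le_left h1
    · exact div_nonneg (sq_nonneg _) (mul_nonneg hM (hpos _).le)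
    · rcases hM.eq_or_lt with hM0 | hM0
      · simp [cHat, ← hM0]
      · have hsq : (p.1 - p.2) ^ 2 ≤ max p.1 p.2 ^ 2 := by
          apply sq_le_sq'
          · linarith [le_max_right p.1 p.2]
          · linarith [le_max_left p.1 p.2]
        calc cHat f p.1 p.2 ≤ max p.1 p.2 ^ 2 / (max p.1 p.2 * valueAtZero f) := by
              apply div_le_div₀ (sq_nonneg _) hsq (mul_pos hM0 hreg)
              exact mul_le_mul_of_nonneg_left (hf.valueAtZero_le_extended _) hM
          _ = max p.1 p.2 / valueAtZero f := by field_simp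
  · refine ContinuousAt.continuousWithinAt ?_
    have hd : ContinuousAt (fun p : ℝ × ℝ => min p.1 p.2 / max p.1 p.2) (x, y) :=
      ContinuousAt.div (by fun_prop) (by fun_prop) h0
    refine ContinuousAt.div (by fun_prop) ?_ (mul_ne_zero h0 (hpos _).ne')
    exact ContinuousAt.mul (by fun_prop) (hc.continuousAt.comp hd)

section Calculus

variable {n : Type*} [Fintype n] [DecidableEq n]

/-- The double spectral formula does not depend on the chosen diagonalization. -/
theorem spectralForm_congr (g : ℝ → ℝ → ℝ) {U V : Matrix n n ℂ} {lam mu : n → ℝ}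
    (hU : U ∈ unitaryGroup n ℂ) (hV : V ∈ unitaryGroup n ℂ)
    (h : U * diagonal (fun i => (lam i : ℂ)) * Uᴴ = V * diagonal (fun i => (mu i : ℂ)) * Vᴴ)
    (X : Matrix n n ℂ) : spectralForm g U lam X = spectralForm g V mu X := by
  have hU1 : Uᴴ * U = 1 := mem_unitaryGroup_iff'.1 hU
  have hU2 : U * Uᴴ = 1 := mem_unitaryGroup_iff.1 hU
  have hV1 : Vᴴ * V = 1 := mem_unitaryGroup_iff'.1 hV
  have hV2 : V * Vᴴ = 1 := mem_unitaryGroup_iff.1 hV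
  set W := Uᴴ * V with hW
  have hUW : U * W = V := by rw [hW, ← Matrix.mul_assoc, hU2, Matrix.one_mul]
  have hint : diagonal (fun i => (lam i : ℂ)) * W = W * diagonal (fun i => (mu i : ℂ)) := by
    calc diagonal (fun i => (lam i : ℂ)) * W
        = Uᴴ * U * diagonal (fun i => (lam i : ℂ)) * (Uᴴ * V) := by rw [hU1, Matrix.one_mul]
      _ = Uᴴ * (U * diagonal (fun i => (lam i : ℂ)) * Uᴴ) * V := by
          simp only [Matrix.mul_assoc]
      _ = Uᴴ * (V * diagonal (fun i => (mu i : ℂ)) * Vᴴ) * V := by rw [h]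
      _ = Uᴴ * V * diagonal (fun i => (mu i : ℂ)) * (Vᴴ * V) := by simp only [Matrix.mul_assoc]
      _ = _ := by rw [hV1, Matrix.mul_one]
  have hent : ∀ i k, W i k ≠ 0 → lam i = mu k := by
    intro i k hik
    have := congrFun (congrFun hint i) k
    rw [diagonal_mul, mul_diagonal, mul_comm] at this
    exact_mod_cast mul_left_cancel₀ hik this
  set Y := Vᴴ * X * V with hY
  have hX : Uᴴ * X * U = W * Y * Wᴴ := by
    rw [hW, hY, conjTranspose_mul, conjTranspose_conjTranspose]
    calc Uᴴ * X * U = Uᴴ * (V * Vᴴ) * X * (V * Vᴴ) * U := by simp [hV2]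
      _ = _ := by simp only [Matrix.mul_assoc]
  have hmid : (Matrix.of fun i j => (g (lam i) (lam j) : ℂ) * (Uᴴ * X * U) i j) =
      W * (Matrix.of fun i j => (g (mu i) (mu j) : ℂ) * Y i j) * Wᴴ := by
    rw [hX]
    ext i j
    simp only [Matrix.of_apply, Matrix.mul_apply, conjTranspose_apply, Finset.sum_mul,
      Finset.mul_sum]
    refine Finset.sum_congr rfl fun l _ => Finset.sum_congr rfl fun k _ => ?_
    by_cases h1 : W i k = 0
    · simp [h1]
    by_cases h2 : W j l = 0
    · simp [h2]
    rw [hent i k h1, hent j l h2]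
    ring
  have hWU : Wᴴ * Uᴴ = Vᴴ := by rw [← conjTranspose_mul, hUW]
  unfold spectralForm
  rw [hmid, ← hY]
  generalize (Matrix.of fun i j => (g (mu i) (mu j) : ℂ) * Y i j) = G
  calc U * (W * G * Wᴴ) * Uᴴ = (U * W) * G * (Wᴴ * Uᴴ) := by simp only [Matrix.mul_assoc]
    _ = V * G * Vᴴ := by rw [hUW, hWU]

theorem eigen_eq {ρ : Matrix n n ℂ} (hρ : ρ.IsHermitian) :
    (hρ.eigenvectorUnitary : Matrix n n ℂ) * diagonal (fun i => (hρ.eigenvalues i : ℂ)) *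
      (hρ.eigenvectorUnitary : Matrix n n ℂ)ᴴ = ρ := by
  conv_rhs => rw [hρ.spectral_theorem, Unitary.conjStarAlgAut_apply]
  rfl

/-- `g(x, y) = x` gives left multiplication. -/
theorem leftRight_fst {ρ : Matrix n n ℂ} (hρ : ρ.IsHermitian) (X : Matrix n n ℂ) :
    leftRight (fun x _ => x) hρ X = ρ * X := by
  have hU2 : (hρ.eigenvectorUnitary : Matrix n n ℂ) * (hρ.eigenvectorUnitary : Matrix n n ℂ)ᴴ = 1 :=
    mem_unitaryGroup_iff.1 hρ.eigenvectorUnitary.2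
  conv_rhs => rw [← eigen_eq hρ]
  unfold leftRight spectralForm
  set U := (hρ.eigenvectorUnitary : Matrix n n ℂ)
  rw [show (Matrix.of fun i j => (hρ.eigenvalues i : ℂ) * (Uᴴ * X * U) i j) =
    diagonal (fun i => (hρ.eigenvalues i : ℂ)) * (Uᴴ * X * U) by
      ext i j; simp [diagonal_mul]]
  simp only [Matrix.mul_assoc, hU2, Matrix.mul_one]

/-- `g(x, y) = y` gives right multiplication. -/
theorem leftRight_snd {ρ : Matrix n n ℂ} (hρ : ρ.IsHermitian) (X : Matrix n n ℂ) :
    leftRight (fun _ y => y) hρ X = X * ρ := by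
  have hU2 : (hρ.eigenvectorUnitary : Matrix n n ℂ) * (hρ.eigenvectorUnitary : Matrix n n ℂ)ᴴ = 1 :=
    mem_unitaryGroup_iff.1 hρ.eigenvectorUnitary.2
  conv_rhs => rw [← eigen_eq hρ]
  unfold leftRight spectralForm
  set U := (hρ.eigenvectorUnitary : Matrix n n ℂ)
  rw [show (Matrix.of fun i j => (hρ.eigenvalues j : ℂ) * (Uᴴ * X * U) i j) =
    (Uᴴ * X * U) * diagonal (fun i => (hρ.eigenvalues i : ℂ)) by
      ext i j; simp [mul_diagonal, mul_comm]]
  simp only [← Matrix.mul_assoc, hU2, Matrix.one_mul]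

theorem trace_spectralForm (g : ℝ → ℝ → ℝ) (U : Matrix n n ℂ) (lam : n → ℝ)
    (X Y : Matrix n n ℂ) :
    (Xᴴ * spectralForm g U lam Y).trace =
      ∑ i, ∑ j, star ((Uᴴ * X * U) i j) * ((g (lam i) (lam j) : ℂ) * (Uᴴ * Y * U) i j) := by
  have h : (Xᴴ * spectralForm g U lam Y).trace = ((Uᴴ * X * U)ᴴ *
      (Matrix.of fun i j => (g (lam i) (lam j) : ℂ) * (Uᴴ * Y * U) i j)).trace := by
    unfold spectralForm
    rw [← Matrix.mul_assoc, Matrix.trace_mul_comm]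
    simp only [conjTranspose_mul, conjTranspose_conjTranspose, Matrix.mul_assoc]
  rw [h]
  generalize Uᴴ * X * U = P
  generalize Uᴴ * Y * U = Q
  rw [Finset.sum_comm]
  simp only [Matrix.trace, Matrix.diag_apply, Matrix.mul_apply, conjTranspose_apply,
    Matrix.of_apply]

theorem conj_commutator {R U : Matrix n n ℂ} {lam : n → ℝ} (hU1 : Uᴴ * U = 1)
    (he : U * diagonal (fun i => (lam i : ℂ)) * Uᴴ = R) (A : Matrix n n ℂ) :
    Uᴴ * (Complex.I • (R * A - A * R)) * U =
      Complex.I • (diagonal (fun i => (lam i : ℂ)) * (Uᴴ * A * U) -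
        (Uᴴ * A * U) * diagonal (fun i => (lam i : ℂ))) := by
  generalize diagonal (fun i => (lam i : ℂ)) = D at he ⊢
  have e1 : Uᴴ * R = D * Uᴴ := by
    rw [← he, ← Matrix.mul_assoc, ← Matrix.mul_assoc, hU1, Matrix.one_mul]
  have e2 : R * U = U * D := by
    rw [← he, Matrix.mul_assoc, hU1, Matrix.mul_one]
  rw [Matrix.mul_smul, Matrix.smul_mul, Matrix.mul_sub, Matrix.sub_mul, ← Matrix.mul_assoc, e1,
    Matrix.mul_assoc Uᴴ (A * R) U, Matrix.mul_assoc A R U, e2]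
  simp only [Matrix.mul_assoc]

/-- On the state manifold the skew information is `f(0)/2 Tr A* cHat(L_ρ, R_ρ) A`. -/
theorem skewInformationOnManifold_eq {f : ℝ → ℝ} (hf : IsFop f) {ρ : DensityMatrix n}
    (hρ : ρ ∈ DensityMatrix.stateManifold n) (A : Matrix n n ℂ) :
    skewInformationOnManifold f ρ A =
      valueAtZero f / 2 * (Aᴴ * leftRight (cHat f) ρ.isHermitian A).trace.re := by
  have hpos : ∀ i, 0 < ρ.isHermitian.eigenvalues i := fun i =>
    Matrix.PosDef.eigenvalues_pos hρ i
  unfold skewInformationOnManifold monotoneMetric leftRight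
  rw [trace_spectralForm, trace_spectralForm]
  have hU1 : (ρ.isHermitian.eigenvectorUnitary : Matrix n n ℂ)ᴴ *
      (ρ.isHermitian.eigenvectorUnitary : Matrix n n ℂ) = 1 :=
    mem_unitaryGroup_iff'.1 ρ.isHermitian.eigenvectorUnitary.2
  have he := eigen_eq ρ.isHermitian
  set U := (ρ.isHermitian.eigenvectorUnitary : Matrix n n ℂ)
  set lam := ρ.isHermitian.eigenvalues
  have hcomm := conj_commutator hU1 he A
  rw [hcomm]
  congr 2
  refine Finset.sum_congr rfl fun i _ => Finset.sum_congr rfl fun j _ => ?_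
  generalize Uᴴ * A * U = P
  rw [hf.cHat_eq (hpos i) (hpos j), Matrix.smul_apply, Matrix.sub_apply, diagonal_mul, mul_diagonal]
  simp only [smul_eq_mul, star_mul', star_sub, Complex.star_def, Complex.conj_I,
    Complex.conj_ofReal]
  push_cast
  linear_combination (-((starRingEnd ℂ) (P i j) * P i j *
    (morozovaChentsov f (lam i) (lam j) : ℂ) * ((lam i : ℂ) - lam j) ^ 2)) * Complex.I_sq

theorem isCompact_unitaryGroup : IsCompact (unitaryGroup n ℂ : Set (Matrix n n ℂ)) := by
  have hbox : IsCompact (Set.pi Set.univ fun _ : n => Set.pi Set.univ fun _ : n =>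
      Metric.closedBall (0 : ℂ) 1) :=
    isCompact_univ_pi fun _ => isCompact_univ_pi fun _ => isCompact_closedBall _ _
  refine IsCompact.of_isClosed_subset hbox ?_ ?_
  · have : (unitaryGroup n ℂ : Set (Matrix n n ℂ)) = {U | U * Uᴴ = 1} := by
      ext U
      exact mem_unitaryGroup_iff
    rw [this]
    exact isClosed_eq (by fun_prop) continuous_const
  · intro U hU i _ j _
    rw [mem_closedBall_zero_iff]
    exact entry_norm_bound_of_unitary hU i j

/-- The density matrix with given eigenvectors and eigenvalues. -/
def ofSpectrum (p : unitaryGroup n ℂ × stdSimplex ℝ n) : DensityMatrix n where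
  toMatrix := (p.1 : Matrix n n ℂ) * diagonal (fun i => ((p.2 : n → ℝ) i : ℂ)) *
    (p.1 : Matrix n n ℂ)ᴴ
  posSemidef := by
    refine Matrix.PosSemidef.mul_mul_conjTranspose_same (Matrix.PosSemidef.diagonal fun i => ?_) _
    simp only [Pi.zero_apply]
    exact_mod_cast p.2.2.1 i
  trace_eq_one := by
    have h : (p.1 : Matrix n n ℂ)ᴴ * (p.1 : Matrix n n ℂ) = 1 := mem_unitaryGroup_iff'.1 p.1.2
    rw [Matrix.trace_mul_comm, ← Matrix.mul_assoc, h, Matrix.one_mul, trace_diagonal]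
    exact_mod_cast p.2.2.2

theorem isQuotientMap_ofSpectrum : IsQuotientMap (ofSpectrum (n := n)) := by
  have : CompactSpace (unitaryGroup n ℂ) := isCompact_iff_compactSpace.1 isCompact_unitaryGroup
  have : T2Space (DensityMatrix n) :=
    T2Space.of_injective_continuous (f := DensityMatrix.toMatrix)
      (fun _ _ h => DensityMatrix.ext h) continuous_induced_dom
  have hcont : Continuous (ofSpectrum (n := n)) := by
    rw [continuous_induced_rng]
    have h1 : Continuous fun p : unitaryGroup n ℂ × stdSimplex ℝ n => (p.1 : Matrix n n ℂ) :=
      continuous_subtype_val.comp continuous_fst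
    have h2 : Continuous fun p : unitaryGroup n ℂ × stdSimplex ℝ n => (p.2 : n → ℝ) :=
      continuous_subtype_val.comp continuous_snd
    have h3 : Continuous fun p : unitaryGroup n ℂ × stdSimplex ℝ n =>
        diagonal (fun i => ((p.2 : n → ℝ) i : ℂ)) :=
      Continuous.matrix_diagonal (continuous_pi fun i =>
        Complex.continuous_ofReal.comp ((continuous_apply i).comp h2))
    exact (h1.matrix_mul h3).matrix_mul h1.matrix_conjTranspose
  refine hcont.isClosedMap.isQuotientMap hcont fun ρ => ?_
  refine ⟨(ρ.isHermitian.eigenvectorUnitary, ⟨ρ.isHermitian.eigenvalues, ?_, ?_⟩), ?_⟩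
  · exact fun i => ρ.posSemidef.eigenvalues_nonneg i
  · have := ρ.isHermitian.trace_eq_sum_eigenvalues
    rw [ρ.trace_eq_one] at this
    exact Complex.ofReal_injective (by simpa using this.symm)
  · exact DensityMatrix.ext (eigen_eq ρ.isHermitian)

theorem continuous_leftRight {g : ℝ → ℝ → ℝ}
    (hg : ContinuousOn (fun p : ℝ × ℝ => g p.1 p.2) (Set.Ici 0 ×ˢ Set.Ici 0))
    (X : Matrix n n ℂ) :
    Continuous fun ρ : DensityMatrix n => leftRight g ρ.isHermitian X := by
  rw [isQuotientMap_ofSpectrum.continuous_iff]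
  have e : (fun ρ : DensityMatrix n => leftRight g ρ.isHermitian X) ∘ ofSpectrum =
      fun p => spectralForm g (p.1 : Matrix n n ℂ) (p.2 : n → ℝ) X := by
    funext p
    exact spectralForm_congr g (ofSpectrum p).isHermitian.eigenvectorUnitary.2 p.1.2
      (eigen_eq (ofSpectrum p).isHermitian) X
  rw [e]
  have h1 : Continuous fun p : unitaryGroup n ℂ × stdSimplex ℝ n => (p.1 : Matrix n n ℂ) :=
    continuous_subtype_val.comp continuous_fst
  have h2 : Continuous fun p : unitaryGroup n ℂ × stdSimplex ℝ n => (p.2 : n → ℝ) :=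
    continuous_subtype_val.comp continuous_snd
  unfold spectralForm
  refine (h1.matrix_mul ?_).matrix_mul h1.matrix_conjTranspose
  refine continuous_matrix fun i j => ?_
  simp only [Matrix.of_apply]
  refine Continuous.mul (Complex.continuous_ofReal.comp ?_) ?_
  · exact hg.comp_continuous (((continuous_apply i).comp h2).prodMk ((continuous_apply j).comp h2))
      fun p => ⟨p.2.2.1 i, p.2.2.1 j⟩
  · exact ((h1.matrix_conjTranspose.matrix_mul continuous_const).matrix_mul h1).matrix_elem i j

theorem dense_stateManifold : Dense (DensityMatrix.stateManifold n) := by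
  intro ρ
  have hne : Nonempty n := by
    by_contra h
    rw [not_nonempty_iff] at h
    have := ρ.trace_eq_one
    simp [Matrix.trace] at this
  have hN : (0 : ℝ) < Fintype.card n := by exact_mod_cast Fintype.card_pos
  let M : ℝ → Matrix n n ℂ := fun ε =>
    ((1 - ε : ℝ) : ℂ) • ρ.toMatrix + ((ε / Fintype.card n : ℝ) : ℂ) • (1 : Matrix n n ℂ)
  have hpd : ∀ ε ∈ Set.Ioc (0 : ℝ) 1, (M ε).PosDef := by
    intro ε hε
    refine Matrix.PosDef.posSemidef_add (ρ.posSemidef.smul ?_) (Matrix.PosDef.one.smul ?_)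
    · exact_mod_cast sub_nonneg.2 hε.2
    · exact_mod_cast div_pos hε.1 hN
  have htr : ∀ ε, (M ε).trace = 1 := by
    intro ε
    simp only [M, Matrix.trace_add, Matrix.trace_smul, ρ.trace_eq_one, Matrix.trace_one, smul_eq_mul]
    have : (Fintype.card n : ℂ) ≠ 0 := by exact_mod_cast hN.ne'
    push_cast
    field_simp
    ring
  have hM : Tendsto M (𝓝[>] 0) (𝓝 ρ.toMatrix) := by
    have hc : Continuous M := by fun_prop
    have := (hc.tendsto 0).mono_left (nhdsWithin_le_nhds (s := Set.Ioi 0))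
    simpa [M] using this
  have hev : ∀ᶠ ε in 𝓝[>] (0 : ℝ), ε ∈ Set.Ioc (0 : ℝ) 1 := Ioc_mem_nhdsGT one_pos
  classical
  let D : ℝ → DensityMatrix n := fun ε =>
    if h : ε ∈ Set.Ioc (0 : ℝ) 1 then ⟨M ε, (hpd ε h).posSemidef, htr ε⟩ else ρ
  have hD : Tendsto D (𝓝[>] 0) (𝓝 ρ) := by
    rw [nhds_induced, tendsto_comap_iff]
    refine hM.congr' ?_
    filter_upwards [hev] with ε hε
    simp [D, hε.1, hε.2]
  refine mem_closure_of_tendsto hD ?_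
  filter_upwards [hev] with ε hε
  have : D ε = ⟨M ε, (hpd ε hε).posSemidef, htr ε⟩ := dif_pos hε
  rw [this]
  exact hpd ε hε

/-- The extension to all density matrices exists and has the expected closed form. -/
theorem skewInformation_eq {f : ℝ → ℝ} (hf : IsFop f) (hreg : IsRegular f)
    (ρ : DensityMatrix n) (A : Matrix n n ℂ) :
    skewInformation f ρ A =
      valueAtZero f / 2 * (Aᴴ * leftRight (cHat f) ρ.isHermitian A).trace.re := by
  have hc : Continuous fun σ : DensityMatrix n =>
      valueAtZero f / 2 * (Aᴴ * leftRight (cHat f) σ.isHermitian A).trace.re := by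
    have := continuous_leftRight (n := n) (hf.continuousOn_cHat hreg) A
    exact continuous_const.mul (Complex.continuous_re.comp
      (continuous_const.matrix_mul this).matrix_trace)
  refine extendFrom_eq (dense_stateManifold ρ) ?_
  refine ((hc.tendsto ρ).mono_left nhdsWithin_le_nhds).congr' ?_
  filter_upwards [self_mem_nhdsWithin] with σ hσ
  exact (skewInformationOnManifold_eq hf hσ A).symm

theorem continuous_skewInformation {f : ℝ → ℝ} (hf : IsFop f) (hreg : IsRegular f)
    (A : Matrix n n ℂ) : Continuous fun ρ : DensityMatrix n => skewInformation f ρ A := by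
  simp only [skewInformation_eq hf hreg]
  have := continuous_leftRight (n := n) (hf.continuousOn_cHat hreg) A
  exact continuous_const.mul (Complex.continuous_re.comp
    (continuous_const.matrix_mul this).matrix_trace)

theorem skewInformation_of_mem {f : ℝ → ℝ} (hf : IsFop f) (hreg : IsRegular f)
    {ρ : DensityMatrix n} (hρ : ρ ∈ DensityMatrix.stateManifold n) (A : Matrix n n ℂ) :
    skewInformation f ρ A = skewInformationOnManifold f ρ A := by
  rw [skewInformation_eq hf hreg, skewInformationOnManifold_eq hf hρ]

end Calculus

end SkewInfo

end

/-!
Both inequalities follow from the fact that the monotone metric contracts under partial traces.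
Let `φ(A) = A ⊗ 1`, whose adjoint for the trace pairing is the partial trace over the second factor.
That partial trace sends `i[ρ, A ⊗ 1 + 1 ⊗ B]` to `i[ρ₁, A]`, the summand `1 ⊗ B` dropping out because
it commutes with the range of `φ`. Contraction of the metric therefore gives
`I_ρ(A ⊗ 1 + 1 ⊗ B) ≥ I_{ρ₁}(A)` for positive definite `ρ`, and by density and continuity for all `ρ`
(`skewInformation_partialTrace₂_le`). The same holds for `ρ₂` and `B`, and the mean of the two bounds
is the first inequality. The second is the parallelogram law (`skewInformation_add_add_sub`)
together with the cases `B = 0` and `A = 0`.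

Contraction (`IsFop.re_monotoneMetric_le`) uses neither Löwner's integral representation nor the
general theory of operator means. With `Δ_ρ = L_ρ R_ρ⁻¹`, the map
`V = R_ρ^{1/2} φ R_{ρ₁}^{-1/2}` is an isometry between Hilbert-Schmidt spaces and
`V* Δ_ρ V = Δ_{ρ₁}`. Jensen's inequality `V* f(T) V ≤ f(V* T V)` at `T = Δ_ρ`
then gives `φ* R_ρ f(Δ_ρ) φ ≤ R_{ρ₁} f(Δ_{ρ₁})`, and passing to inverses moves `φ` and `φ*` to the
other side (`sum_adjoint_div_le_of_sum_le`), which is the contraction since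
`c(L_ρ, R_ρ) = (R_ρ f(Δ_ρ))⁻¹`.

Jensen's inequality (`IsFop.sum_compression_le`) comes directly from operator monotonicity:
`T ≤ (1 + δ) V (V* T V) V* + μ (1 - V V*)` for every `δ > 0` and a large `μ`
(`posSemidef_dilation_sub`), the right-hand side is block diagonal, so applying `f` and compressing
by `V` gives `V* f(T) V ≤ f((1 + δ) V* T V) ≤ (1 + δ) f(V* T V)`, and `δ` tends to zero. The second
step is `f((1 + δ) s) ≤ (1 + δ) f(s)`, a consequence of the symmetry `f(t) = t f(1/t)`.

All operators involved are diagonal in eigenbases of `ρ` and `ρ₁`, so the argument is carried out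
for diagonal matrices `T` and `V* T V`; only the comparison operator is not diagonal.
-/

namespace SkewInfo

/-! ### Jensen's inequality for compressions -/

section Jensen

variable {ι κ : Type*} [Fintype ι] [DecidableEq ι] [Fintype κ] [DecidableEq κ]

/-- The functional calculus acts on eigenvectors, here the columns of `V`, through the eigenvalues.
No continuity of `f` is needed, the spectrum being finite. -/
theorem cfc_mul_eq_mul_diagonal (f : ℝ → ℝ) {S : Matrix ι ι ℂ} (hS : S.IsHermitian)
    {V : Matrix ι κ ℂ} {d : κ → ℝ} (h : S * V = V * diagonal (fun a => (d a : ℂ))) :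
    cfc f S * V = V * diagonal (fun a => (f (d a) : ℂ)) := by
  have hU1 : (hS.eigenvectorUnitary : Matrix ι ι ℂ)ᴴ * (hS.eigenvectorUnitary : Matrix ι ι ℂ) = 1 :=
    mem_unitaryGroup_iff'.1 hS.eigenvectorUnitary.2
  have hU2 : (hS.eigenvectorUnitary : Matrix ι ι ℂ) * (hS.eigenvectorUnitary : Matrix ι ι ℂ)ᴴ = 1 :=
    mem_unitaryGroup_iff.1 hS.eigenvectorUnitary.2
  have he := eigen_eq hS
  have hc : cfc f S = (hS.eigenvectorUnitary : Matrix ι ι ℂ) *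
      diagonal (fun i => (f (hS.eigenvalues i) : ℂ)) *
        (hS.eigenvectorUnitary : Matrix ι ι ℂ)ᴴ := by
    rw [hS.cfc_eq, Matrix.IsHermitian.cfc, Unitary.conjStarAlgAut_apply]
    rfl
  rw [hc]
  generalize (hS.eigenvectorUnitary : Matrix ι ι ℂ) = U at hU1 hU2 he
  have hW : diagonal (fun i => (hS.eigenvalues i : ℂ)) * (Uᴴ * V) =
      (Uᴴ * V) * diagonal (fun a => (d a : ℂ)) := by
    rw [Matrix.mul_assoc, ← h]
    nth_rw 2 [← he]
    simp only [← Matrix.mul_assoc, hU1, Matrix.one_mul]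
  -- a nonzero entry of `Uᴴ V` forces the two eigenvalues to agree, hence also their images
  have hW' : diagonal (fun i => (f (hS.eigenvalues i) : ℂ)) * (Uᴴ * V) =
      (Uᴴ * V) * diagonal (fun a => (f (d a) : ℂ)) := by
    generalize Uᴴ * V = W at hW
    ext i a
    have := congrFun (congrFun hW i) a
    rw [diagonal_mul, mul_diagonal, mul_comm] at this ⊢
    by_cases h0 : W i a = 0
    · simp [h0]
    · rw [show hS.eigenvalues i = d a by exact_mod_cast mul_left_cancel₀ h0 this]
  rw [Matrix.mul_assoc, Matrix.mul_assoc, hW', ← Matrix.mul_assoc, ← Matrix.mul_assoc, hU2,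
    Matrix.one_mul]

theorem cfc_diagonal (f : ℝ → ℝ) (t : ι → ℝ) :
    cfc f (diagonal (fun i => (t i : ℂ))) = diagonal (fun i => (f (t i) : ℂ)) := by
  have hS : (diagonal (fun i => (t i : ℂ))).IsHermitian := by
    rw [Matrix.isHermitian_diagonal_iff]
    intro i
    simp [isSelfAdjoint_iff]
  simpa using cfc_mul_eq_mul_diagonal f hS (V := 1) (d := t) (by simp)

theorem re_star_dotProduct_diagonal_mulVec (d : ι → ℝ) (x : ι → ℂ) :
    (star x ⬝ᵥ (diagonal (fun i => (d i : ℂ)) *ᵥ x)).re = ∑ i, d i * ‖x i‖ ^ 2 := by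
  simp only [dotProduct, mulVec_diagonal, Complex.re_sum, Pi.star_apply]
  refine Finset.sum_congr rfl fun i _ => ?_
  rw [show star (x i) * ((d i : ℂ) * x i) = (d i : ℂ) * (x i * star (x i)) by ring,
    Complex.star_def, Complex.mul_conj, Complex.normSq_eq_norm_sq]
  norm_cast

/-- A positive operator is dominated by a block diagonal one: up to a factor `1 + δ` on the range
of the isometry `V`, and a large multiple of the projection onto its complement. -/
theorem posSemidef_dilation_sub {t : ι → ℝ} (ht : ∀ i, 0 < t i) {V : Matrix ι κ ℂ}
    (hV : Vᴴ * V = 1) {δ : ℝ} (hδ : 0 < δ) :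
    (((1 + δ : ℝ) : ℂ) • (V * Vᴴ * diagonal (fun i => (t i : ℂ)) * (V * Vᴴ)) +
      (((1 + δ⁻¹) * ∑ i, t i : ℝ) : ℂ) • (1 - V * Vᴴ) -
        diagonal (fun i => (t i : ℂ))).PosSemidef := by
  have hP : V * Vᴴ * (V * Vᴴ) = V * Vᴴ := by
    rw [Matrix.mul_assoc, ← Matrix.mul_assoc Vᴴ, hV, Matrix.one_mul]
  obtain ⟨Q, hQ⟩ : ∃ Q, Q = 1 - V * Vᴴ := ⟨_, rfl⟩
  have hQQ : Q * Q = Q := by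
    rw [hQ, Matrix.sub_mul, Matrix.mul_sub, Matrix.mul_sub, hP]; simp
  have hQH : Qᴴ = Q := by rw [hQ]; simp
  have hPQ : V * Vᴴ = 1 - Q := by rw [hQ]; simp
  rw [← hQ, hPQ]
  set lam : ℝ := (1 + δ⁻¹) * ∑ i, t i
  set T := diagonal (fun i => (t i : ℂ)) with hT
  have hT0 : (((δ : ℝ) : ℂ) • T).PosSemidef := by
    refine PosSemidef.smul (PosSemidef.diagonal fun i => ?_) ?_
    · simp only [Pi.zero_apply]; exact_mod_cast (ht i).le
    · exact_mod_cast hδ.le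
  have hT1 : ((lam : ℂ) • (1 : Matrix ι ι ℂ) - ((1 + δ⁻¹ : ℝ) : ℂ) • T).PosSemidef := by
    have e : (lam : ℂ) • (1 : Matrix ι ι ℂ) - ((1 + δ⁻¹ : ℝ) : ℂ) • T =
        diagonal (fun i => ((lam - (1 + δ⁻¹) * t i : ℝ) : ℂ)) := by
      ext i j
      by_cases h : i = j <;> simp [hT, h]
    rw [e]
    refine PosSemidef.diagonal fun i => ?_
    simp only [Pi.zero_apply]
    have : t i ≤ ∑ i, t i := Finset.single_le_sum (fun i _ => (ht i).le) (Finset.mem_univ i)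
    have h1 : 0 ≤ lam - (1 + δ⁻¹) * t i :=
      sub_nonneg.2 (mul_le_mul_of_nonneg_left this (by positivity))
    exact_mod_cast h1
  -- with `P = V Vᴴ = 1 - Q`, the difference is `(P - δ⁻¹Q) δT (P - δ⁻¹Q) + Q (lam - (1 + δ⁻¹)T) Q`;
  -- the first term absorbs the off-diagonal blocks of `T`
  have h1 := hT0.conjTranspose_mul_mul_same ((1 - Q) - ((δ⁻¹ : ℝ) : ℂ) • Q)
  have h2 := hT1.conjTranspose_mul_mul_same Q
  have h12 := h1.add h2
  have hδ' : (δ : ℂ) ≠ 0 := by exact_mod_cast hδ.ne'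
  convert h12 using 1
  simp only [conjTranspose_sub, conjTranspose_one, conjTranspose_smul, hQH, Complex.star_def,
    Complex.conj_ofReal, Matrix.sub_mul, Matrix.mul_sub, Matrix.smul_mul, Matrix.mul_smul,
    Matrix.one_mul, Matrix.mul_one, hQQ]
  push_cast
  match_scalars <;> field_simp <;> ring

/-- Jensen's inequality for an operator monotone function and the isometry `V`, at a compression
that is diagonal, as an inequality between quadratic forms. The index type is the one for which
operator monotonicity is stated. -/
theorem IsFop.sum_compression_le_fin {f : ℝ → ℝ} (hf : IsFop f) {k : ℕ}
    {t : Fin k → ℝ} (ht : ∀ i, 0 < t i)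
    {s : κ → ℝ} (hs : ∀ a, 0 < s a) {V : Matrix (Fin k) κ ℂ} (hV : Vᴴ * V = 1)
    (hVs : Vᴴ * diagonal (fun i => (t i : ℂ)) * V = diagonal (fun a => (s a : ℂ))) (x : κ → ℂ) :
    ∑ i, f (t i) * ‖(V *ᵥ x) i‖ ^ 2 ≤ ∑ a, f (s a) * ‖x a‖ ^ 2 := by
  have hT : (diagonal (fun i => (t i : ℂ))).PosDef := PosDef.diagonal fun i => by
    exact_mod_cast ht i
  have key : ∀ δ : ℝ, 0 < δ →
      ∑ i, f (t i) * ‖(V *ᵥ x) i‖ ^ 2 ≤ (1 + δ) * ∑ a, f (s a) * ‖x a‖ ^ 2 := by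
    intro δ hδ
    have hD := posSemidef_dilation_sub ht hV hδ
    set S := ((1 + δ : ℝ) : ℂ) • (V * Vᴴ * diagonal (fun i => (t i : ℂ)) * (V * Vᴴ)) +
      (((1 + δ⁻¹) * ∑ i, t i : ℝ) : ℂ) • (1 - V * Vᴴ) with hSdef
    have hS : S.PosDef := by
      have := hT.add_posSemidef hD
      rwa [add_sub_cancel] at this
    -- `S` maps the range of `V` to itself, so that `f(S)` is known there
    have hSV : S * V = V * diagonal (fun a => (((1 + δ) * s a : ℝ) : ℂ)) := by
      have e : diagonal (fun a => (((1 + δ) * s a : ℝ) : ℂ)) =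
          ((1 + δ : ℝ) : ℂ) • diagonal (fun a => (s a : ℂ)) := by
        rw [← diagonal_smul]; congr 1; ext a; simp
      rw [e, ← hVs, hSdef, Matrix.add_mul, Matrix.smul_mul, Matrix.smul_mul, Matrix.sub_mul,
        Matrix.mul_smul, Matrix.one_mul, Matrix.mul_assoc V Vᴴ V, hV, Matrix.mul_one, sub_self,
        smul_zero, add_zero]
      simp only [Matrix.mul_assoc, hV, Matrix.mul_one]
    have hle := hf.operatorMonotone k _ S hT hS hD
    have hform := (hle.conjTranspose_mul_mul_same V).re_dotProduct_nonneg x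
    rw [Matrix.mul_sub, Matrix.sub_mul, Matrix.mul_assoc Vᴴ (cfc f S),
      cfc_mul_eq_mul_diagonal f hS.1 hSV, ← Matrix.mul_assoc, hV, Matrix.one_mul, cfc_diagonal,
      Matrix.sub_mulVec, dotProduct_sub, ← mulVec_mulVec, ← mulVec_mulVec,
      dotProduct_mulVec _ Vᴴ, ← star_mulVec, RCLike.re_eq_complex_re, Complex.sub_re,
      re_star_dotProduct_diagonal_mulVec, re_star_dotProduct_diagonal_mulVec] at hform
    rw [Finset.mul_sum]
    refine (sub_nonneg.1 hform).trans (Finset.sum_le_sum fun a _ => ?_)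
    rw [← mul_assoc]
    refine mul_le_mul_of_nonneg_right ?_ (by positivity)
    have := hf.div_antitone (hs a) (t := (1 + δ) * s a) (by nlinarith [hs a])
    rwa [mul_div_cancel_right₀ _ (hs a).ne'] at this
  have hlim : Tendsto (fun δ : ℝ => (1 + δ) * ∑ a, f (s a) * ‖x a‖ ^ 2) (𝓝[>] 0)
      (𝓝 (∑ a, f (s a) * ‖x a‖ ^ 2)) := by
    have : Continuous fun δ : ℝ => (1 + δ) * ∑ a, f (s a) * ‖x a‖ ^ 2 := by fun_prop
    simpa using (this.tendsto 0).mono_left (nhdsWithin_le_nhds (s := Set.Ioi 0))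
  exact ge_of_tendsto hlim (by filter_upwards [self_mem_nhdsWithin] with δ hδ using key δ hδ)

theorem IsFop.sum_compression_le {f : ℝ → ℝ} (hf : IsFop f) {t : ι → ℝ} (ht : ∀ i, 0 < t i)
    {s : κ → ℝ} (hs : ∀ a, 0 < s a) {V : Matrix ι κ ℂ} (hV : Vᴴ * V = 1)
    (hVs : Vᴴ * diagonal (fun i => (t i : ℂ)) * V = diagonal (fun a => (s a : ℂ))) (x : κ → ℂ) :
    ∑ i, f (t i) * ‖(V *ᵥ x) i‖ ^ 2 ≤ ∑ a, f (s a) * ‖x a‖ ^ 2 := by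
  let e := (Fintype.equivFin ι).symm
  rw [← e.sum_comp]
  refine hf.sum_compression_le_fin (t := t ∘ e) (fun i => ht _) hs (V := V.submatrix e id) ?_ ?_ x
  · rw [conjTranspose_submatrix, submatrix_mul_equiv Vᴴ V id e id, hV]
    exact submatrix_one_equiv (Equiv.refl κ)
  · have h : diagonal (fun i => ((t ∘ e) i : ℂ)) =
        (diagonal (fun i => (t i : ℂ))).submatrix e e :=
      (submatrix_diagonal_equiv (fun i => (t i : ℂ)) e).symm
    rw [h, conjTranspose_submatrix, submatrix_mul_equiv _ _ id e e, submatrix_mul_equiv _ _ id e id,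
      hVs, submatrix_id_id]

end Jensen

/-! ### Monotonicity of weighted quadratic forms -/

section Weights

theorem conjTranspose_diagonal_ofReal {ι : Type*} [DecidableEq ι] (d : ι → ℝ) :
    (diagonal (fun i => (d i : ℂ)))ᴴ = diagonal (fun i => (d i : ℂ)) := by
  rw [diagonal_conjTranspose]
  congr 1
  ext i
  simp

variable {ι κ : Type*} [Fintype ι] [Fintype κ]

/-- Jensen's inequality for the isometry `diag(√q) E diag(√q')⁻¹`, which compresses `diag(p / q)`
to `diag(p' / q')`. -/
theorem IsFop.sum_perspective_le [DecidableEq ι] [DecidableEq κ] {f : ℝ → ℝ} (hf : IsFop f)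
    {E : Matrix ι κ ℂ} {p q : ι → ℝ}
    {p' q' : κ → ℝ} (hp : ∀ i, 0 < p i) (hq : ∀ i, 0 < q i) (hp' : ∀ a, 0 < p' a)
    (hq' : ∀ a, 0 < q' a)
    (hEp : Eᴴ * diagonal (fun i => (p i : ℂ)) * E = diagonal (fun a => (p' a : ℂ)))
    (hEq : Eᴴ * diagonal (fun i => (q i : ℂ)) * E = diagonal (fun a => (q' a : ℂ)))
    (z : κ → ℂ) :
    ∑ i, q i * f (p i / q i) * ‖(E *ᵥ z) i‖ ^ 2 ≤ ∑ a, q' a * f (p' a / q' a) * ‖z a‖ ^ 2 := by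
  set V : Matrix ι κ ℂ := diagonal (fun i => ((√(q i) : ℝ) : ℂ)) * E *
    diagonal (fun a => (((√(q' a))⁻¹ : ℝ) : ℂ)) with hVdef
  have hsq : ∀ i, √(q i) * √(q i) = q i := fun i => Real.mul_self_sqrt (hq i).le
  have hinv : ∀ a r, (√(q' a))⁻¹ * r * (√(q' a))⁻¹ = r / q' a := fun a r => by
    rw [mul_right_comm, ← mul_inv, Real.mul_self_sqrt (hq' a).le, div_eq_inv_mul]
  have hs0 : ∀ a, √(q' a) ≠ 0 := fun a => (Real.sqrt_pos.2 (hq' a)).ne'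
  have hconj : ∀ r : ι → ℝ, Vᴴ * diagonal (fun i => (r i : ℂ)) * V =
      diagonal (fun a => (((√(q' a))⁻¹ : ℝ) : ℂ)) *
        (Eᴴ * diagonal (fun i => ((r i * q i : ℝ) : ℂ)) * E) *
          diagonal (fun a => (((√(q' a))⁻¹ : ℝ) : ℂ)) := by
    intro r
    have e : diagonal (fun i => ((r i * q i : ℝ) : ℂ)) =
        diagonal (fun i => ((√(q i) : ℝ) : ℂ)) * diagonal (fun i => (r i : ℂ)) *
          diagonal (fun i => ((√(q i) : ℝ) : ℂ)) := by
      rw [diagonal_mul_diagonal, diagonal_mul_diagonal]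
      congr 1
      ext i
      rw [← Complex.ofReal_mul, ← Complex.ofReal_mul]
      congr 1
      linear_combination -(r i) * hsq i
    rw [e, hVdef, conjTranspose_mul, conjTranspose_mul, conjTranspose_diagonal_ofReal,
      conjTranspose_diagonal_ofReal]
    simp only [Matrix.mul_assoc]
  have hV : Vᴴ * V = 1 := by
    have := hconj fun _ => 1
    simp only [one_mul, Complex.ofReal_one, diagonal_one, Matrix.mul_one] at this
    rw [this, hEq, diagonal_mul_diagonal, diagonal_mul_diagonal, ← diagonal_one]
    congr 1
    ext a
    rw [← Complex.ofReal_mul, ← Complex.ofReal_mul, hinv, div_self (hq' a).ne', Complex.ofReal_one]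
  have hVs : Vᴴ * diagonal (fun i => ((p i / q i : ℝ) : ℂ)) * V =
      diagonal (fun a => ((p' a / q' a : ℝ) : ℂ)) := by
    rw [hconj fun i => p i / q i]
    have e : (fun i => ((p i / q i * q i : ℝ) : ℂ)) = fun i => (p i : ℂ) := by
      ext i
      rw [div_mul_cancel₀ _ (hq i).ne']
    rw [e, hEp, diagonal_mul_diagonal, diagonal_mul_diagonal]
    congr 1
    ext a
    rw [← Complex.ofReal_mul, ← Complex.ofReal_mul, hinv]
  have := hf.sum_compression_le (fun i => div_pos (hp i) (hq i))
    (fun a => div_pos (hp' a) (hq' a)) hV hVs (fun a => ((√(q' a) : ℝ) : ℂ) * z a)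
  have hVz : V *ᵥ (fun a => ((√(q' a) : ℝ) : ℂ) * z a) =
      fun i => ((√(q i) : ℝ) : ℂ) * (E *ᵥ z) i := by
    rw [hVdef, ← mulVec_mulVec, ← mulVec_mulVec]
    have e : diagonal (fun a => (((√(q' a))⁻¹ : ℝ) : ℂ)) *ᵥ
        (fun a => ((√(q' a) : ℝ) : ℂ) * z a) = z := by
      ext a
      rw [mulVec_diagonal, ← mul_assoc, ← Complex.ofReal_mul, inv_mul_cancel₀ (hs0 a)]
      simp
    rw [e]
    ext i
    rw [mulVec_diagonal]
  rw [hVz] at this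
  simp only [norm_mul, mul_pow, Complex.norm_real, Real.norm_eq_abs, sq_abs] at this
  convert this using 2 with i _ a _
  · rw [Real.sq_sqrt (hq i).le]; ring
  · rw [Real.sq_sqrt (hq' a).le]; ring

/-- A bound `Eᴴ J E ≤ J'` for positive diagonal weights passes to the inverse weights in the form
`E J'⁻¹ Eᴴ ≤ J⁻¹`. -/
theorem sum_adjoint_div_le_of_sum_le {E : Matrix ι κ ℂ} {J : ι → ℝ} {J' : κ → ℝ}
    (hJ : ∀ i, 0 < J i) (hJ' : ∀ a, 0 < J' a)
    (h : ∀ z : κ → ℂ, ∑ i, J i * ‖(E *ᵥ z) i‖ ^ 2 ≤ ∑ a, J' a * ‖z a‖ ^ 2) (X : ι → ℂ) :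
    ∑ a, ‖(Eᴴ *ᵥ X) a‖ ^ 2 / J' a ≤ ∑ i, ‖X i‖ ^ 2 / J i := by
  set Y := Eᴴ *ᵥ X with hY
  -- `z = J'⁻¹ Eᴴ X` makes both `⟨z, J' z⟩` and `⟨E z, X⟩` equal to the left-hand side
  set z : κ → ℂ := fun a => Y a / J' a with hz
  have hz1 : ∑ a, J' a * ‖z a‖ ^ 2 = ∑ a, ‖Y a‖ ^ 2 / J' a := by
    refine Finset.sum_congr rfl fun a _ => ?_
    have := (hJ' a).ne'
    simp only [hz, norm_div, Complex.norm_real, Real.norm_eq_abs, abs_of_pos (hJ' a)]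
    field_simp
  have hz2 : ∑ i, (star (E *ᵥ z) i * X i).re = ∑ a, ‖Y a‖ ^ 2 / J' a := by
    rw [← Complex.re_sum]
    change (star (E *ᵥ z) ⬝ᵥ X).re = _
    rw [star_mulVec, ← dotProduct_mulVec, ← hY, dotProduct, Complex.re_sum]
    refine Finset.sum_congr rfl fun a _ => ?_
    simp only [hz, Pi.star_apply, star_div₀, Complex.star_def, Complex.conj_ofReal]
    rw [div_mul_eq_mul_div, mul_comm, Complex.mul_conj, Complex.normSq_eq_norm_sq]
    norm_cast
  -- the sum of the squares `J |E z - J⁻¹ X|²` is nonnegative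
  have hsq : ∀ i, 0 ≤ J i * ‖(E *ᵥ z) i‖ ^ 2 - 2 * (star (E *ᵥ z) i * X i).re +
      ‖X i‖ ^ 2 / J i := by
    intro i
    have h0 := (hJ i).ne'
    have : 0 ≤ J i * Complex.normSq ((E *ᵥ z) i - X i / J i) :=
      mul_nonneg (hJ i).le (Complex.normSq_nonneg _)
    rw [← Complex.normSq_eq_norm_sq, ← Complex.normSq_eq_norm_sq]
    convert this using 1
    simp only [Complex.normSq_apply, Pi.star_apply, Complex.star_def, Complex.mul_re,
      Complex.conj_re, Complex.conj_im, Complex.sub_re, Complex.sub_im, Complex.div_ofReal_re,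
      Complex.div_ofReal_im]
    field_simp
    ring
  have hsum := Finset.sum_nonneg fun i (_ : i ∈ Finset.univ) => hsq i
  rw [Finset.sum_add_distrib, Finset.sum_sub_distrib, ← Finset.mul_sum, hz2] at hsum
  have := h z
  rw [hz1] at this
  linarith

end Weights

/-! ### Monotonicity of the metric -/

section Metric

variable {ι κ : Type*} [Fintype ι] [Fintype κ]

theorem trace_conjTranspose_mul_eq_sum (A B : Matrix ι ι ℂ) :
    (Aᴴ * B).trace = ∑ p : ι × ι, star (A p.1 p.2) * B p.1 p.2 := by
  rw [Fintype.sum_prod_type_right]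
  simp only [Matrix.trace, Matrix.diag_apply, Matrix.mul_apply, conjTranspose_apply]

variable [DecidableEq ι] [DecidableEq κ]

theorem re_monotoneMetric_self (f : ℝ → ℝ) (ρ : DensityMatrix ι) (X : Matrix ι ι ℂ) :
    (monotoneMetric f ρ X X).re = ∑ p : ι × ι,
      ‖((ρ.isHermitian.eigenvectorUnitary : Matrix ι ι ℂ)ᴴ * X *
        (ρ.isHermitian.eigenvectorUnitary : Matrix ι ι ℂ)) p.1 p.2‖ ^ 2 /
      (ρ.isHermitian.eigenvalues p.2 *
        f (ρ.isHermitian.eigenvalues p.1 / ρ.isHermitian.eigenvalues p.2)) := by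
  unfold monotoneMetric leftRight
  rw [trace_spectralForm, ← Fintype.sum_prod_type', Complex.re_sum]
  refine Finset.sum_congr rfl fun p _ => ?_
  generalize ((ρ.isHermitian.eigenvectorUnitary : Matrix ι ι ℂ)ᴴ * X *
        (ρ.isHermitian.eigenvectorUnitary : Matrix ι ι ℂ)) p.1 p.2 = w
  rw [mul_left_comm, mul_comm (star w), Complex.star_def, Complex.mul_conj,
    Complex.normSq_eq_norm_sq, ← Complex.ofReal_mul, Complex.ofReal_re, morozovaChentsov]
  ring

/-- The embedding `φ` in matrix units: the columns are `φ(|w a⟩⟨w b|)`, where `(w a)` are the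
columns of `W`, and the rows are the entries with respect to the columns of `U`. -/
def embeddingMatrix (φ : Matrix κ κ ℂ →⋆ₐ[ℂ] Matrix ι ι ℂ) (U : Matrix ι ι ℂ) (W : Matrix κ κ ℂ) :
    Matrix (ι × ι) (κ × κ) ℂ :=
  Matrix.of fun p a => (Uᴴ * φ (W * single a.1 a.2 1 * Wᴴ) * U) p.1 p.2

/-- The conjugate transpose of the embedding matrix represents the adjoint of `φ` for the trace
pairing, which sends `X` to `Y`. -/
theorem embeddingMatrix_conjTranspose_mulVec {φ : Matrix κ κ ℂ →⋆ₐ[ℂ] Matrix ι ι ℂ}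
    {U : Matrix ι ι ℂ} (hU : U * Uᴴ = 1) (W : Matrix κ κ ℂ) {X : Matrix ι ι ℂ} {Y : Matrix κ κ ℂ}
    (hXY : ∀ Z, (φ Z * X).trace = (Z * Y).trace) :
    (embeddingMatrix φ U W)ᴴ *ᵥ (fun p => (Uᴴ * X * U) p.1 p.2) =
      fun a => (Wᴴ * Y * W) a.1 a.2 := by
  ext a
  have h1 : ((embeddingMatrix φ U W)ᴴ *ᵥ (fun p => (Uᴴ * X * U) p.1 p.2)) a =
      ((Uᴴ * φ (W * single a.1 a.2 1 * Wᴴ) * U)ᴴ * (Uᴴ * X * U)).trace := by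
    rw [trace_conjTranspose_mul_eq_sum]
    rfl
  have h2 : (Uᴴ * φ (W * single a.1 a.2 1 * Wᴴ) * U)ᴴ * (Uᴴ * X * U) =
      Uᴴ * (φ (W * single a.2 a.1 1 * Wᴴ) * X * U) := by
    simp only [conjTranspose_mul, conjTranspose_conjTranspose, ← star_eq_conjTranspose (φ _),
      ← map_star]
    simp only [star_eq_conjTranspose, conjTranspose_mul, conjTranspose_conjTranspose,
      conjTranspose_single, star_one, Matrix.mul_assoc]
    rw [← Matrix.mul_assoc U Uᴴ, hU, Matrix.one_mul]
  rw [h1, h2, Matrix.trace_mul_comm, Matrix.mul_assoc, hU, Matrix.mul_one, hXY,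
    Matrix.mul_assoc, Matrix.mul_assoc, Matrix.trace_mul_comm, Matrix.mul_assoc,
    Matrix.trace_single_mul, one_smul]

section Compression

variable {φ : Matrix κ κ ℂ →⋆ₐ[ℂ] Matrix ι ι ℂ} {U : Matrix ι ι ℂ} {W : Matrix κ κ ℂ}
  {lam : ι → ℝ} {mu : κ → ℝ}

/-- `Eᴴ L_ρ E = L_σ` for the embedding matrix `E` of `φ` in eigenbases, when `σ` is the image of `ρ`
under the adjoint of `φ`. -/
theorem embeddingMatrix_compression_fst (hU : U * Uᴴ = 1) (hU' : Uᴴ * U = 1) (hW : Wᴴ * W = 1)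
    (h : ∀ Z, (φ Z * (U * diagonal (fun i => (lam i : ℂ)) * Uᴴ)).trace =
      (Z * (W * diagonal (fun a => (mu a : ℂ)) * Wᴴ)).trace) :
    (embeddingMatrix φ U W)ᴴ * diagonal (fun p : ι × ι => (lam p.1 : ℂ)) *
      embeddingMatrix φ U W = diagonal (fun a : κ × κ => (mu a.1 : ℂ)) := by
  ext a c
  set Z := W * single c.1 c.2 1 * Wᴴ with hZ
  have hXY : ∀ Z', (φ Z' * (U * diagonal (fun i => (lam i : ℂ)) * Uᴴ * φ Z)).trace =
      (Z' * (W * diagonal (fun a => (mu a : ℂ)) * Wᴴ * Z)).trace := by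
    intro Z'
    have h' := h (Z * Z')
    generalize U * diagonal (fun i => (lam i : ℂ)) * Uᴴ = R at h' ⊢
    generalize W * diagonal (fun a => (mu a : ℂ)) * Wᴴ = S at h' ⊢
    rw [← Matrix.mul_assoc, Matrix.trace_mul_comm, ← Matrix.mul_assoc, ← map_mul, h',
      ← Matrix.mul_assoc Z', Matrix.trace_mul_comm _ Z, ← Matrix.mul_assoc]
  have hcol : (fun p : ι × ι => (diagonal (fun p : ι × ι => (lam p.1 : ℂ)) *
      embeddingMatrix φ U W) p c) =
      fun p => (Uᴴ * (U * diagonal (fun i => (lam i : ℂ)) * Uᴴ * φ Z) * U) p.1 p.2 := by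
    ext p
    have e : Uᴴ * (U * diagonal (fun i => (lam i : ℂ)) * Uᴴ * φ Z) * U =
        diagonal (fun i => (lam i : ℂ)) * (Uᴴ * φ Z * U) := by
      simp only [← Matrix.mul_assoc, hU', Matrix.one_mul]
    rw [e, diagonal_mul, diagonal_mul]
    rfl
  have hr : Wᴴ * (W * diagonal (fun a => (mu a : ℂ)) * Wᴴ * Z) * W =
      diagonal (fun a => (mu a : ℂ)) * single c.1 c.2 1 := by
    simp only [hZ, Matrix.mul_assoc, hW, Matrix.mul_one]
    simp only [← Matrix.mul_assoc, hW, Matrix.one_mul]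
  have := congrFun (embeddingMatrix_conjTranspose_mulVec hU W hXY) a
  rw [← hcol, hr] at this
  rw [Matrix.mul_assoc, Matrix.mul_apply]
  refine this.trans ?_
  rw [diagonal_mul, single_apply, diagonal_apply]
  by_cases hac : a = c
  · simp [hac]
  · have : ¬ (c.1 = a.1 ∧ c.2 = a.2) := fun h => hac (Prod.ext h.1.symm h.2.symm)
    simp [hac, this]

/-- `Eᴴ R_ρ E = R_σ` for the embedding matrix `E` of `φ` in eigenbases, when `σ` is the image of `ρ`
under the adjoint of `φ`. -/
theorem embeddingMatrix_compression_snd (hU : U * Uᴴ = 1) (hU' : Uᴴ * U = 1) (hW : Wᴴ * W = 1)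
    (h : ∀ Z, (φ Z * (U * diagonal (fun i => (lam i : ℂ)) * Uᴴ)).trace =
      (Z * (W * diagonal (fun a => (mu a : ℂ)) * Wᴴ)).trace) :
    (embeddingMatrix φ U W)ᴴ * diagonal (fun p : ι × ι => (lam p.2 : ℂ)) *
      embeddingMatrix φ U W = diagonal (fun a : κ × κ => (mu a.2 : ℂ)) := by
  ext a c
  set Z := W * single c.1 c.2 1 * Wᴴ with hZ
  have hXY : ∀ Z', (φ Z' * (φ Z * (U * diagonal (fun i => (lam i : ℂ)) * Uᴴ))).trace =
      (Z' * (Z * (W * diagonal (fun a => (mu a : ℂ)) * Wᴴ))).trace := by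
    intro Z'
    rw [← Matrix.mul_assoc, ← map_mul, h, Matrix.mul_assoc]
  have hcol : (fun p : ι × ι => (diagonal (fun p : ι × ι => (lam p.2 : ℂ)) *
      embeddingMatrix φ U W) p c) =
      fun p => (Uᴴ * (φ Z * (U * diagonal (fun i => (lam i : ℂ)) * Uᴴ)) * U) p.1 p.2 := by
    ext p
    have e : Uᴴ * (φ Z * (U * diagonal (fun i => (lam i : ℂ)) * Uᴴ)) * U =
        (Uᴴ * φ Z * U) * diagonal (fun i => (lam i : ℂ)) := by
      simp only [Matrix.mul_assoc, hU', Matrix.mul_one]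
    rw [e, diagonal_mul, mul_diagonal, mul_comm]
    rfl
  have hr : Wᴴ * (Z * (W * diagonal (fun a => (mu a : ℂ)) * Wᴴ)) * W =
      single c.1 c.2 1 * diagonal (fun a => (mu a : ℂ)) := by
    simp only [hZ, Matrix.mul_assoc, hW, Matrix.mul_one]
    simp only [← Matrix.mul_assoc, hW, Matrix.one_mul]
  have := congrFun (embeddingMatrix_conjTranspose_mulVec hU W hXY) a
  rw [← hcol, hr] at this
  rw [Matrix.mul_assoc, Matrix.mul_apply]
  refine this.trans ?_
  rw [mul_diagonal, single_apply, diagonal_apply]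
  by_cases hac : a = c
  · simp [hac]
  · have : ¬ (c.1 = a.1 ∧ c.2 = a.2) := fun h => hac (Prod.ext h.1.symm h.2.symm)
    simp [hac, this]

end Compression

/-- The metric contracts under the adjoint of a unital `*`-homomorphism `φ`; here `σ` and `Y` are
the images of `ρ` and `X` under that adjoint. -/
theorem IsFop.re_monotoneMetric_le {f : ℝ → ℝ} (hf : IsFop f) {ρ : DensityMatrix ι}
    (hρ : ρ ∈ DensityMatrix.stateManifold ι) {σ : DensityMatrix κ}
    (hσ : σ ∈ DensityMatrix.stateManifold κ) (φ : Matrix κ κ ℂ →⋆ₐ[ℂ] Matrix ι ι ℂ)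
    (hρσ : ∀ Z, (φ Z * ρ.toMatrix).trace = (Z * σ.toMatrix).trace)
    {X : Matrix ι ι ℂ} {Y : Matrix κ κ ℂ} (hXY : ∀ Z, (φ Z * X).trace = (Z * Y).trace) :
    (monotoneMetric f σ Y Y).re ≤ (monotoneMetric f ρ X X).re := by
  have hlam : ∀ i, 0 < ρ.isHermitian.eigenvalues i := fun i =>
    Matrix.PosDef.eigenvalues_pos hρ i
  have hmu : ∀ a, 0 < σ.isHermitian.eigenvalues a := fun a =>
    Matrix.PosDef.eigenvalues_pos hσ a
  have hU := mem_unitaryGroup_iff.1 ρ.isHermitian.eigenvectorUnitary.2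
  have hU' := mem_unitaryGroup_iff'.1 ρ.isHermitian.eigenvectorUnitary.2
  have hW' := mem_unitaryGroup_iff'.1 σ.isHermitian.eigenvectorUnitary.2
  have h : ∀ Z, (φ Z * ((ρ.isHermitian.eigenvectorUnitary : Matrix ι ι ℂ) *
      diagonal (fun i => (ρ.isHermitian.eigenvalues i : ℂ)) *
      (ρ.isHermitian.eigenvectorUnitary : Matrix ι ι ℂ)ᴴ)).trace =
      (Z * ((σ.isHermitian.eigenvectorUnitary : Matrix κ κ ℂ) *
      diagonal (fun a => (σ.isHermitian.eigenvalues a : ℂ)) *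
      (σ.isHermitian.eigenvectorUnitary : Matrix κ κ ℂ)ᴴ)).trace := by
    rw [eigen_eq, eigen_eq]
    exact hρσ
  rw [re_monotoneMetric_self, re_monotoneMetric_self]
  have := sum_adjoint_div_le_of_sum_le
    (fun p : ι × ι => mul_pos (hlam p.2) (hf.pos _ (div_pos (hlam p.1) (hlam p.2))))
    (fun a : κ × κ => mul_pos (hmu a.2) (hf.pos _ (div_pos (hmu a.1) (hmu a.2))))
    (hf.sum_perspective_le (fun p => hlam p.1) (fun p => hlam p.2) (fun a => hmu a.1)
      (fun a => hmu a.2) (embeddingMatrix_compression_fst hU hU' hW' h)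
      (embeddingMatrix_compression_snd hU hU' hW' h))
    (fun p : ι × ι => ((ρ.isHermitian.eigenvectorUnitary : Matrix ι ι ℂ)ᴴ * X *
        (ρ.isHermitian.eigenvectorUnitary : Matrix ι ι ℂ)) p.1 p.2)
  rwa [embeddingMatrix_conjTranspose_mulVec hU _ hXY] at this

end Metric

/-! ### Consequences for the skew information -/

section SkewInformation

variable {ι κ : Type*} [Fintype ι] [DecidableEq ι] [Fintype κ] [DecidableEq κ]

/-- A summand `C` of the observable that commutes with the subalgebra `φ(M_κ)` is invisible after
restriction to that subalgebra, because the adjoint of `φ` sends `[ρ, C]` to zero. -/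
theorem IsFop.skewInformationOnManifold_le {f : ℝ → ℝ} (hf : IsFop f) (hreg : IsRegular f)
    {ρ : DensityMatrix ι} (hρ : ρ ∈ DensityMatrix.stateManifold ι) {σ : DensityMatrix κ}
    (hσ : σ ∈ DensityMatrix.stateManifold κ) (φ : Matrix κ κ ℂ →⋆ₐ[ℂ] Matrix ι ι ℂ)
    (hρσ : ∀ Z, (φ Z * ρ.toMatrix).trace = (Z * σ.toMatrix).trace)
    (A : Matrix κ κ ℂ) {C : Matrix ι ι ℂ} (hC : ∀ Z, Commute C (φ Z)) :
    skewInformationOnManifold f σ A ≤ skewInformationOnManifold f ρ (φ A + C) := by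
  unfold skewInformationOnManifold
  refine mul_le_mul_of_nonneg_left (hf.re_monotoneMetric_le hρ hσ φ hρσ fun Z => ?_)
    (half_pos hreg).le
  have h1 : (φ Z * (ρ.toMatrix * (φ A + C))).trace = (φ ((A * Z)) * ρ.toMatrix).trace +
      (φ Z * C * ρ.toMatrix).trace := by
    rw [← Matrix.mul_assoc, Matrix.trace_mul_comm, Matrix.add_mul, Matrix.trace_add,
      ← Matrix.mul_assoc, ← Matrix.mul_assoc, map_mul, (hC Z).eq]
  have h2 : (φ Z * ((φ A + C) * ρ.toMatrix)).trace = (φ ((Z * A)) * ρ.toMatrix).trace +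
      (φ Z * C * ρ.toMatrix).trace := by
    rw [← Matrix.mul_assoc, Matrix.mul_add, Matrix.add_mul, Matrix.trace_add, map_mul]
  rw [Matrix.mul_smul, Matrix.mul_smul, Matrix.trace_smul, Matrix.trace_smul, Matrix.mul_sub,
    Matrix.mul_sub, Matrix.trace_sub, Matrix.trace_sub, h1, h2, hρσ, hρσ,
    ← Matrix.mul_assoc Z σ.toMatrix, Matrix.trace_mul_comm (Z * σ.toMatrix),
    ← Matrix.mul_assoc A, ← Matrix.mul_assoc Z A, add_sub_add_right_eq_sub]

/-- The parallelogram law, as the skew information is a quadratic form in the observable. -/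
theorem skewInformation_add_add_sub {f : ℝ → ℝ} (hf : IsFop f) (hreg : IsRegular f)
    (ρ : DensityMatrix ι) (X Y : Matrix ι ι ℂ) :
    skewInformation f ρ (X + Y) + skewInformation f ρ (X - Y) =
      2 * (skewInformation f ρ X + skewInformation f ρ Y) := by
  have key : ∀ (g : ℝ → ℝ → ℝ) (U : Matrix ι ι ℂ) (lam : ι → ℝ),
      ((X + Y)ᴴ * spectralForm g U lam (X + Y)).trace +
        ((X - Y)ᴴ * spectralForm g U lam (X - Y)).trace =
      2 * ((Xᴴ * spectralForm g U lam X).trace + (Yᴴ * spectralForm g U lam Y).trace) := by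
    intro g U lam
    simp only [trace_spectralForm, Matrix.mul_add, Matrix.add_mul, Matrix.mul_sub, Matrix.sub_mul,
      ← Finset.sum_add_distrib, Finset.mul_sum]
    refine Finset.sum_congr rfl fun i _ => Finset.sum_congr rfl fun j _ => ?_
    rw [Matrix.add_apply, Matrix.sub_apply, star_add, star_sub]
    ring
  have := congrArg Complex.re (key (cHat f) ρ.isHermitian.eigenvectorUnitary
    ρ.isHermitian.eigenvalues)
  rw [Complex.add_re, show (2 : ℂ) = ((2 : ℝ) : ℂ) by norm_num, Complex.re_ofReal_mul,
    Complex.add_re] at this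
  simp only [skewInformation_eq hf hreg, leftRight]
  rw [← mul_add, this]
  ring

end SkewInformation

/-! ### Partial traces -/

section PartialTrace

variable {m n : Type*} [Fintype m] [Fintype n]

theorem DensityMatrix.nonempty {ι : Type*} [Fintype ι] (ρ : DensityMatrix ι) : Nonempty ι := by
  by_contra h
  rw [not_nonempty_iff] at h
  simpa [Matrix.trace] using ρ.trace_eq_one

theorem partialTrace₂_mem_stateManifold {ρ : DensityMatrix (m × n)}
    (hρ : ρ ∈ DensityMatrix.stateManifold (m × n)) :
    ρ.partialTrace₂ ∈ DensityMatrix.stateManifold m := by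
  classical
  obtain ⟨_, k⟩ := ρ.nonempty.some
  have h : ρ.partialTrace₂.toMatrix =
      ∑ k, ρ.toMatrix.submatrix (fun i : m => (i, k)) (fun i : m => (i, k)) := by
    ext i j
    simp [Matrix.sum_apply, DensityMatrix.partialTrace₂]
  change ρ.partialTrace₂.toMatrix.PosDef
  rw [h, ← Finset.add_sum_erase _ _ (Finset.mem_univ k)]
  exact (PosDef.submatrix hρ fun _ _ h => (Prod.ext_iff.1 h).1).add_posSemidef
    (posSemidef_sum _ fun k _ => ρ.posSemidef.submatrix _)

theorem partialTrace₁_mem_stateManifold {ρ : DensityMatrix (m × n)}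
    (hρ : ρ ∈ DensityMatrix.stateManifold (m × n)) :
    ρ.partialTrace₁ ∈ DensityMatrix.stateManifold n := by
  classical
  obtain ⟨k, _⟩ := ρ.nonempty.some
  have h : ρ.partialTrace₁.toMatrix =
      ∑ k, ρ.toMatrix.submatrix (fun i : n => (k, i)) (fun i : n => (k, i)) := by
    ext i j
    simp [Matrix.sum_apply, DensityMatrix.partialTrace₁]
  change ρ.partialTrace₁.toMatrix.PosDef
  rw [h, ← Finset.add_sum_erase _ _ (Finset.mem_univ k)]
  exact (PosDef.submatrix hρ fun _ _ h => (Prod.ext_iff.1 h).2).add_posSemidef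
    (posSemidef_sum _ fun k _ => ρ.posSemidef.submatrix _)

theorem continuous_partialTrace₂ :
    Continuous (DensityMatrix.partialTrace₂ : DensityMatrix (m × n) → DensityMatrix m) := by
  have h : Continuous (DensityMatrix.toMatrix (n := m × n)) := continuous_induced_dom
  rw [continuous_induced_rng]
  exact continuous_matrix fun i j => continuous_finsetSum _ fun k _ => h.matrix_elem _ _

theorem continuous_partialTrace₁ :
    Continuous (DensityMatrix.partialTrace₁ : DensityMatrix (m × n) → DensityMatrix n) := by
  have h : Continuous (DensityMatrix.toMatrix (n := m × n)) := continuous_induced_dom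
  rw [continuous_induced_rng]
  exact continuous_matrix fun i j => continuous_finsetSum _ fun k _ => h.matrix_elem _ _

variable [DecidableEq m] [DecidableEq n]

/-- The embedding `A ↦ A ⊗ 1` of the first factor. -/
def kroneckerLeft (m n : Type*) [Fintype m] [DecidableEq m] [Fintype n] [DecidableEq n] :
    Matrix m m ℂ →⋆ₐ[ℂ] Matrix (m × n) (m × n) ℂ where
  toFun A := A ⊗ₖ (1 : Matrix n n ℂ)
  map_one' := one_kronecker_one
  map_mul' A B := by rw [← mul_kronecker_mul, Matrix.one_mul]
  map_zero' := zero_kronecker _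
  map_add' A B := add_kronecker A B _
  commutes' r := by
    rw [Algebra.algebraMap_eq_smul_one, smul_kronecker, one_kronecker_one,
      Algebra.algebraMap_eq_smul_one]
  map_star' A := by
    simp only [star_eq_conjTranspose, conjTranspose_kronecker, conjTranspose_one]

/-- The embedding `B ↦ 1 ⊗ B` of the second factor. -/
def kroneckerRight (m n : Type*) [Fintype m] [DecidableEq m] [Fintype n] [DecidableEq n] :
    Matrix n n ℂ →⋆ₐ[ℂ] Matrix (m × n) (m × n) ℂ where
  toFun B := (1 : Matrix m m ℂ) ⊗ₖ B
  map_one' := one_kronecker_one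
  map_mul' A B := by rw [← mul_kronecker_mul, Matrix.one_mul]
  map_zero' := kronecker_zero _
  map_add' A B := kronecker_add _ A B
  commutes' r := by
    rw [Algebra.algebraMap_eq_smul_one, kronecker_smul, one_kronecker_one,
      Algebra.algebraMap_eq_smul_one]
  map_star' A := by
    simp only [star_eq_conjTranspose, conjTranspose_kronecker, conjTranspose_one]

@[simp]
theorem kroneckerLeft_apply (A : Matrix m m ℂ) : kroneckerLeft m n A = A ⊗ₖ (1 : Matrix n n ℂ) :=
  rfl

@[simp]
theorem kroneckerRight_apply (B : Matrix n n ℂ) : kroneckerRight m n B = (1 : Matrix m m ℂ) ⊗ₖ B :=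
  rfl

theorem commute_kroneckerRight_kroneckerLeft (A : Matrix m m ℂ) (B : Matrix n n ℂ) :
    Commute (kroneckerRight m n B) (kroneckerLeft m n A) := by
  simp only [Commute, SemiconjBy, kroneckerLeft_apply, kroneckerRight_apply, ← mul_kronecker_mul,
    Matrix.one_mul, Matrix.mul_one]

theorem trace_kroneckerLeft_mul (ρ : DensityMatrix (m × n)) (Z : Matrix m m ℂ) :
    (kroneckerLeft m n Z * ρ.toMatrix).trace = (Z * ρ.partialTrace₂.toMatrix).trace := by
  simp only [Matrix.trace, Matrix.diag_apply, Matrix.mul_apply, kroneckerLeft_apply,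
    kroneckerMap_apply, Fintype.sum_prod_type, DensityMatrix.partialTrace₂, Matrix.of_apply,
    Matrix.one_apply, mul_ite, mul_one, mul_zero, ite_mul, zero_mul, Finset.sum_ite_eq,
    Finset.mem_univ, if_true, Finset.mul_sum]
  exact Finset.sum_congr rfl fun i _ => Finset.sum_comm

theorem trace_kroneckerRight_mul (ρ : DensityMatrix (m × n)) (Z : Matrix n n ℂ) :
    (kroneckerRight m n Z * ρ.toMatrix).trace = (Z * ρ.partialTrace₁.toMatrix).trace := by
  simp only [Matrix.trace, Matrix.diag_apply, Matrix.mul_apply, kroneckerRight_apply,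
    kroneckerMap_apply, Fintype.sum_prod_type_right, DensityMatrix.partialTrace₁, Matrix.of_apply,
    Matrix.one_apply, one_mul, zero_mul, ite_mul, Finset.sum_ite_eq,
    Finset.mem_univ, if_true, Finset.mul_sum]
  exact Finset.sum_congr rfl fun i _ => Finset.sum_comm

/-- Restricting to a subsystem and forgetting the part of the observable that lives on the other
subsystem does not increase the skew information. -/
theorem skewInformation_partialTrace₂_le {f : ℝ → ℝ} (hf : IsFop f) (hreg : IsRegular f)
    (ρ : DensityMatrix (m × n)) (A : Matrix m m ℂ) (B : Matrix n n ℂ) :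
    skewInformation f ρ.partialTrace₂ A ≤
      skewInformation f ρ (A ⊗ₖ (1 : Matrix n n ℂ) + (1 : Matrix m m ℂ) ⊗ₖ B) := by
  refine dense_stateManifold.induction (P := fun ρ => skewInformation f ρ.partialTrace₂ A ≤
    skewInformation f ρ (A ⊗ₖ (1 : Matrix n n ℂ) + (1 : Matrix m m ℂ) ⊗ₖ B)) (fun ρ hρ => ?_)
    (isClosed_le ((continuous_skewInformation hf hreg A).comp continuous_partialTrace₂)
      (continuous_skewInformation hf hreg _)) ρ
  rw [skewInformation_of_mem hf hreg hρ,
    skewInformation_of_mem hf hreg (partialTrace₂_mem_stateManifold hρ)]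
  exact hf.skewInformationOnManifold_le hreg hρ (partialTrace₂_mem_stateManifold hρ)
    (kroneckerLeft m n) (trace_kroneckerLeft_mul ρ) A
    (fun Z => commute_kroneckerRight_kroneckerLeft Z B)

theorem skewInformation_partialTrace₁_le {f : ℝ → ℝ} (hf : IsFop f) (hreg : IsRegular f)
    (ρ : DensityMatrix (m × n)) (A : Matrix m m ℂ) (B : Matrix n n ℂ) :
    skewInformation f ρ.partialTrace₁ B ≤
      skewInformation f ρ (A ⊗ₖ (1 : Matrix n n ℂ) + (1 : Matrix m m ℂ) ⊗ₖ B) := by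
  refine dense_stateManifold.induction (P := fun ρ => skewInformation f ρ.partialTrace₁ B ≤
    skewInformation f ρ (A ⊗ₖ (1 : Matrix n n ℂ) + (1 : Matrix m m ℂ) ⊗ₖ B)) (fun ρ hρ => ?_)
    (isClosed_le ((continuous_skewInformation hf hreg B).comp continuous_partialTrace₁)
      (continuous_skewInformation hf hreg _)) ρ
  rw [skewInformation_of_mem hf hreg hρ,
    skewInformation_of_mem hf hreg (partialTrace₁_mem_stateManifold hρ), add_comm (A ⊗ₖ _)]
  exact hf.skewInformationOnManifold_le hreg hρ (partialTrace₁_mem_stateManifold hρ)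
    (kroneckerRight m n) (trace_kroneckerRight_mul ρ) B
    (fun Z => (commute_kroneckerRight_kroneckerLeft A Z).symm)

end PartialTrace

end SkewInfo

theorem mainTheorem3 {m n : Type*} [Fintype m] [DecidableEq m] [Fintype n] [DecidableEq n]
    (f : ℝ → ℝ) (hf : SkewInfo.IsFop f) (hreg : SkewInfo.IsRegular f)
    (ρ : SkewInfo.DensityMatrix (m × n))
    (A : Matrix m m ℂ) (hA : A.IsHermitian) (B : Matrix n n ℂ) (hB : B.IsHermitian) :
    (SkewInfo.skewInformation f ρ (A ⊗ₖ (1 : Matrix n n ℂ) + (1 : Matrix m m ℂ) ⊗ₖ B) ≥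
      1 / 2 * (SkewInfo.skewInformation f ρ.partialTrace₂ A +
        SkewInfo.skewInformation f ρ.partialTrace₁ B)) ∧
    (SkewInfo.skewInformation f ρ (A ⊗ₖ (1 : Matrix n n ℂ) + (1 : Matrix m m ℂ) ⊗ₖ B) +
      SkewInfo.skewInformation f ρ (A ⊗ₖ (1 : Matrix n n ℂ) - (1 : Matrix m m ℂ) ⊗ₖ B) ≥
      2 * (SkewInfo.skewInformation f ρ.partialTrace₂ A +
        SkewInfo.skewInformation f ρ.partialTrace₁ B)) := by
  have h₂ := SkewInfo.skewInformation_partialTrace₂_le hf hreg ρ A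
  have h₁ := fun A => SkewInfo.skewInformation_partialTrace₁_le hf hreg ρ A B
  refine ⟨by linarith [h₂ B, h₁ A], ?_⟩
  rw [SkewInfo.skewInformation_add_add_sub hf hreg]
  have hA' := h₂ 0
  have hB' := h₁ 0
  rw [kronecker_zero, add_zero] at hA'
  rw [zero_kronecker, zero_add] at hB'
  linarith
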